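/- **Setup.** Let $\mathcal S_1,\mathcal S_2,\mathcal W,\mathcal W_3,\mathcal X_1,\mathcal X_2,\mathcal X_3,\mathcal Y,\mathcal Y_3$ be finite sets. A discrete memoryless multiple-access broadcast relay channel (DM MABRC) with correlated sources and side information is given by an arbitrary joint probability mass function $p(s_1,s_2,w,w_3)$ on $\mathcal S_1\times\mathcal S_2\times\mathcal W\times\mathcal W_3$ and channel transition probabilities $p(y,y_3|x_1,x_2,x_3)$. The tuples $(S_{1,k},S_{2,k},W_k,W_{3,k})$, $k=1,\dots,m$, are i.i.d. with law $p(s_1,s_2,w,w_3)$. An $(m,n)$ code consists of encoders $f_i:\mathcal S_i^m\to\mathcal X_i^n$, $i=1,2$, causal relay encoders $x_{3,k}=f_{3,k}(y_3^{k-1},w_3^m)$, $k=1,\dots,n$, a destination decoder $g:\mathcal Y^n\times\mathcal W^m\to\mathcal S_1^m\times\mathcal S_2^m$ and a relay decoder $g_3:\mathcal Y_3^n\times\mathcal W_3^m\to\mathcal S_1^m\times\mathcal S_2^m$. It induces the joint law $$\prod_{i=1}^m p(s_{1,i},s_{2,i},w_i,w_{3,i})\ \prod_{k=1}^n p\big(y_k,y_{3,k}\,\big|\,f_{1}(s_1^m)_k,\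 f_{2}(s_2^m)_k,\ f_{3,k}(y_3^{k-1},w_3^m)\big),$$ and its error probability $P_e^{(m,n)}$ is the probability that $g(Y^n,W^m)\neq(S_1^m,S_2^m)$ or $g_3(Y_3^n,W_3^m)\neq(S_1^m,S_2^m)$. A source-channel rate $\kappa\in\mathbb R$ is achievable if for every $\epsilon>0$ and all $n_0,m_0$ there are $n>n_0$ and $m>m_0$ with $n\le\kappa m$ and an $(m,n)$ code with $P_e^{(m,n)}<\epsilon$. **Theorem.** If $\kappa$ is achievable for the DM MABRC, then there is a probability mass function $p(x_1,x_2,x_3)$ on $\mathcal X_1\times\mathcal X_2\times\mathcal X_3$ such that, with $(S_1,S_2,W,W_3)\sim p(s_1,s_2,w,w_3)$ and $(X_1,X_2,X_3,Y,Y_3)\sim p(x_1,x_2,x_3)\,p(y,y_3|x_1,x_2,x_3)$, all six of the following hold: $$H(S_1|S_2,W)\le\kappa I(X_1,X_3;Y|X_2),\quad H(S_2|S_1,W)\le\kappa I(X_2,X_3;Y|X_1),\quad H(S_1,S_2|W)\le\kappa I(X_1,X_2,X_3;Y),$$ $$H(S_1|S_2,W_3)\le\kappa I(X_1;Y_3|X_2,X_3),\quad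 H(S_2|S_1,W_3)\le\kappa I(X_2;Y_3|X_1,X_3),\quad H(S_1,S_2|W_3)\le\kappa I(X_1,X_2;Y_3|X_3).$$ -/

import Mathlib

namespace MABRC

section Information

variable {Ω α β γ : Type*} [Fintype Ω] [Fintype α] [Fintype β] [Fintype γ]

open Classical in
/-- The probability mass function of the random variable `X : Ω → α` when the finite sample space
`Ω` carries the probability mass function `p`. -/
noncomputable def law (p : Ω → ℝ) (X : Ω → α) (a : α) : ℝ :=
  ∑ ω, if X ω = a then p ω else 0

/-- Conditional entropy `H(X | Z) = - ∑ p(x, z) log p(x | z)`, in nats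
(terms with `p(x, z) = 0` vanish). -/
noncomputable def condEntropy (p : Ω → ℝ) (X : Ω → α) (Z : Ω → γ) : ℝ :=
  -∑ x, ∑ z, law p (fun ω => (X ω, Z ω)) (x, z) *
    Real.log (law p (fun ω => (X ω, Z ω)) (x, z) / law p Z z)

/-- Mutual information `I(X; Y) = ∑ p(x, y) log (p(x, y) / (p(x) p(y)))`, in nats. -/
noncomputable def mutualInfo (p : Ω → ℝ) (X : Ω → α) (Y : Ω → β) : ℝ :=
  ∑ x, ∑ y, law p (fun ω => (X ω, Y ω)) (x, y) *
    Real.log (law p (fun ω => (X ω, Y ω)) (x, y) / (law p X x * law p Y y))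

/-- Conditional mutual information `I(X; Y | Z) = H(X | Z) - H(X | Y, Z)`, in nats. -/
noncomputable def condMutualInfo (p : Ω → ℝ) (X : Ω → α) (Y : Ω → β) (Z : Ω → γ) : ℝ :=
  condEntropy p X Z - condEntropy p X (fun ω => (Y ω, Z ω))

end Information

section Model

variable (S₁ S₂ W W₃ X₁ X₂ X₃ Y Y₃ : Type*)

/-- The single-letter data of a discrete memoryless multiple-access broadcast relay channel with
correlated sources and side information: the joint probability mass function of
`(S₁, S₂, W, W₃)` and the channel transition probabilities `p(y, y₃ | x₁, x₂, x₃)`, all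
alphabets being finite. -/
structure Model [Fintype S₁] [Fintype S₂] [Fintype W] [Fintype W₃] [Fintype Y] [Fintype Y₃] where
  /-- `p(s₁, s₂, w, w₃)` -/
  src : S₁ × S₂ × W × W₃ → ℝ
  src_mem : src ∈ stdSimplex ℝ (S₁ × S₂ × W × W₃)
  /-- `p(y, y₃ | x₁, x₂, x₃)` -/
  chan : X₁ → X₂ → X₃ → Y × Y₃ → ℝ
  chan_mem : ∀ x₁ x₂ x₃, chan x₁ x₂ x₃ ∈ stdSimplex ℝ (Y × Y₃)

/-- An `(m, n)` source-channel code: `m` source samples are sent in `n` channel uses. -/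
structure Code (m n : ℕ) where
  /-- encoder of the first transmitter -/
  f₁ : (Fin m → S₁) → (Fin n → X₁)
  /-- encoder of the second transmitter -/
  f₂ : (Fin m → S₂) → (Fin n → X₂)
  /-- causal encoders of the relay: the input at time `k` (counted from `0`) depends on the `k`
  relay outputs received before and on the side information of the relay -/
  f₃ : (k : Fin n) → (Fin (k : ℕ) → Y₃) → (Fin m → W₃) → X₃
  /-- decoder of the destination -/
  g : (Fin n → Y) → (Fin m → W) → (Fin m → S₁) × (Fin m → S₂)
  /-- decoder of the relay -/
  g₃ : (Fin n → Y₃) → (Fin m → W₃) → (Fin m → S₁) × (Fin m → S₂)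

end Model

variable {S₁ S₂ W W₃ X₁ X₂ X₃ Y Y₃ : Type*}

/-- The relay input at time `k`, given all relay outputs (only the past ones are used) and the
relay side information. -/
def Code.relayInput {m n : ℕ} (c : Code S₁ S₂ W W₃ X₁ X₂ X₃ Y Y₃ m n)
    (y₃ : Fin n → Y₃) (w₃ : Fin m → W₃) (k : Fin n) : X₃ :=
  c.f₃ k (fun j => y₃ (Fin.castLE k.isLt.le j)) w₃

variable [Fintype S₁] [Fintype S₂] [Fintype W] [Fintype W₃] [Fintype Y] [Fintype Y₃]

/-- The probability that the code produces the source sequences `s₁, s₂`, the side information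
sequences `w, w₃` and the channel output sequences `y, y₃`: the source samples are independent and
identically distributed, and the channel is memoryless and used without feedback. -/
def jointLaw {m n : ℕ} (M : Model S₁ S₂ W W₃ X₁ X₂ X₃ Y Y₃)
    (c : Code S₁ S₂ W W₃ X₁ X₂ X₃ Y Y₃ m n)
    (s₁ : Fin m → S₁) (s₂ : Fin m → S₂) (w : Fin m → W) (w₃ : Fin m → W₃)
    (y : Fin n → Y) (y₃ : Fin n → Y₃) : ℝ :=
  (∏ i, M.src (s₁ i, s₂ i, w i, w₃ i)) *
    ∏ k, M.chan (c.f₁ s₁ k) (c.f₂ s₂ k) (c.relayInput y₃ w₃ k) (y k, y₃ k)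

open Classical in
/-- The average error probability: the destination or the relay fails to recover both source
sequences. -/
noncomputable def errorProb {m n : ℕ} (M : Model S₁ S₂ W W₃ X₁ X₂ X₃ Y Y₃)
    (c : Code S₁ S₂ W W₃ X₁ X₂ X₃ Y Y₃ m n) : ℝ :=
  ∑ s₁ : Fin m → S₁, ∑ s₂ : Fin m → S₂, ∑ w : Fin m → W, ∑ w₃ : Fin m → W₃,
    ∑ y : Fin n → Y, ∑ y₃ : Fin n → Y₃,
      if c.g y w ≠ (s₁, s₂) ∨ c.g₃ y₃ w₃ ≠ (s₁, s₂) then jointLaw M c s₁ s₂ w w₃ y y₃ else 0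

/-- The source-channel rate `κ` (channel uses per source sample) is achievable: for every `ε > 0`
there are `(m, n)` codes with `m` and `n` arbitrarily large, `n ≤ κ m` and error probability less
than `ε`. Nothing is asked of pairs `(m, n)` other than those of the codes; in particular no code is
required for pairs with `n` much smaller than `κ m`. -/
def Achievable (M : Model S₁ S₂ W W₃ X₁ X₂ X₃ Y Y₃) (κ : ℝ) : Prop :=
  ∀ ε : ℝ, 0 < ε → ∀ n₀ m₀ : ℕ, ∃ n m : ℕ, n₀ < n ∧ m₀ < m ∧ (n : ℝ) ≤ κ * m ∧
    ∃ c : Code S₁ S₂ W W₃ X₁ X₂ X₃ Y Y₃ m n, errorProb M c < ε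

/-- The joint probability mass function of the channel inputs and outputs `(X₁, X₂, X₃, Y, Y₃)` for
the input distribution `p(x₁, x₂, x₃)`. -/
def Model.inOut (M : Model S₁ S₂ W W₃ X₁ X₂ X₃ Y Y₃) (p : X₁ × X₂ × X₃ → ℝ) :
    X₁ × X₂ × X₃ × Y × Y₃ → ℝ :=
  fun ω => p (ω.1, ω.2.1, ω.2.2.1) * M.chan ω.1 ω.2.1 ω.2.2.1 ω.2.2.2

/-! The source letters as random variables on `S₁ × S₂ × W × W₃`. -/

/-- the letter of the first source -/
def rvS₁ (ω : S₁ × S₂ × W × W₃) : S₁ := ω.1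
/-- the letter of the second source -/
def rvS₂ (ω : S₁ × S₂ × W × W₃) : S₂ := ω.2.1
/-- the side information letter of the destination -/
def rvW (ω : S₁ × S₂ × W × W₃) : W := ω.2.2.1
/-- the side information letter of the relay -/
def rvW₃ (ω : S₁ × S₂ × W × W₃) : W₃ := ω.2.2.2

/-! The channel inputs and outputs as random variables on `X₁ × X₂ × X₃ × Y × Y₃`. -/

/-- the channel input of the first transmitter -/
def rvX₁ (ω : X₁ × X₂ × X₃ × Y × Y₃) : X₁ := ω.1
/-- the channel input of the second transmitter -/
def rvX₂ (ω : X₁ × X₂ × X₃ × Y × Y₃) : X₂ := ω.2.1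
/-- the channel input of the relay -/
def rvX₃ (ω : X₁ × X₂ × X₃ × Y × Y₃) : X₃ := ω.2.2.1
/-- the channel output at the destination -/
def rvY (ω : X₁ × X₂ × X₃ × Y × Y₃) : Y := ω.2.2.2.1
/-- the channel output at the relay -/
def rvY₃ (ω : X₁ × X₂ × X₃ × Y × Y₃) : Y₃ := ω.2.2.2.2

end MABRC

/-! This is the classical converse: Fano's inequality, the chain rule, memorylessness, time
averaging and compactness. All six bounds are instances of `converse`, with a source component `A`,
side information `B`, an output component `o`, and an input component `u` computable from `B^m` and
the past of `o`.

Write `V` for the block of outputs `o`. Since the source is i.i.d., `m H(A|B) = H(A^m|B^m) =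
[H(V|B^m) - H(V|A^m,B^m)] + H(A^m|B^m,V)`. The last term is small by `fano`. By the chain rule,
`H(V|B^m)` is at most the sum of `H(o_k|u_k)`, because the conditioning variables determine `u_k`.
Also `H(V|A^m,B^m)` is at least the sum of `H(o_k|x_k)`: conditioning further on all sources and the
whole past leaves only the input relevant, as the channel is memoryless. In `sum_infoRate_le` the
differences `H(o_k|u_k) - H(o_k|x_k)` are averaged over time; the first entropy is concave in the
joint law, the second linear in the input law.

For the destination, `u` is the input of the transmitter whose source is known, or constant. For the
relay, `u` also contains its own input, a function of `W₃^m` and past `Y₃`. The averaged input law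
is the same in all six cases, so a single limit point in the compact simplex
(`exists_forall_le_of_approx`) serves them all. -/

namespace MABRC

/-! ### Entropy on a finite sample space: Gibbs, Fano, concavity. -/

section EntropyTheory

variable {Ω α β γ δ : Type*} [Fintype Ω]

open Classical in
theorem sum_law_mul [Fintype α] (p : Ω → ℝ) (X : Ω → α) (f : α → ℝ) :
    ∑ a, law p X a * f a = ∑ ω, p ω * f (X ω) := by
  simp only [law, Finset.sum_mul]
  rw [Finset.sum_comm]
  refine Finset.sum_congr rfl fun ω _ => ?_
  simp [ite_mul]

theorem law_nonneg {p : Ω → ℝ} (hp : ∀ ω, 0 ≤ p ω) (X : Ω → α) (a : α) : 0 ≤ law p X a := by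
  unfold law
  exact Finset.sum_nonneg fun ω _ => by split_ifs <;> simp [hp]

theorem law_pos {p : Ω → ℝ} (hp : ∀ ω, 0 ≤ p ω) (X : Ω → α) {ω : Ω} (hω : 0 < p ω) :
    0 < law p X (X ω) := by
  unfold law
  refine Finset.sum_pos' (fun ω _ => by split_ifs <;> simp [hp]) ⟨ω, Finset.mem_univ _, ?_⟩
  simpa using hω

theorem sum_law [Fintype α] (p : Ω → ℝ) (X : Ω → α) : ∑ a, law p X a = ∑ ω, p ω := by
  simpa using sum_law_mul p X (fun _ => 1)

theorem law_congr (p : Ω → ℝ) {X : Ω → α} {Y : Ω → β} {a : α} {b : β}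
    (h : ∀ ω, X ω = a ↔ Y ω = b) : law p X a = law p Y b := by
  unfold law
  refine Finset.sum_congr rfl fun ω _ => ?_
  by_cases hY : Y ω = b
  · rw [if_pos hY, if_pos ((h ω).2 hY)]
  · rw [if_neg hY, if_neg fun hX => hY ((h ω).1 hX)]

/-- The law of a function of `X` is the push-forward of the law of `X`. -/
theorem law_law [Fintype α] (p : Ω → ℝ) (X : Ω → α) (f : α → β) (b : β) :
    law (law p X) f b = law p (fun ω => f (X ω)) b := by
  classical
  have := sum_law_mul p X (fun a => if f a = b then 1 else 0)
  simpa [law, mul_ite] using this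

/-- The Shannon entropy of `X`, in nats, as an expectation over the sample space. -/
noncomputable def entropy (p : Ω → ℝ) (X : Ω → α) : ℝ :=
  -∑ ω, p ω * Real.log (law p X (X ω))

theorem entropy_eq_sum_negMulLog [Fintype α] (p : Ω → ℝ) (X : Ω → α) :
    entropy p X = ∑ a, Real.negMulLog (law p X a) := by
  simp only [entropy, Real.negMulLog, neg_mul, Finset.sum_neg_distrib]
  rw [sum_law_mul p X (fun a => Real.log (law p X a))]

/-- Entropy depends only on the partition of the sample space into fibres. This permits reordering
tuples and dropping components determined by others. -/
theorem entropy_congr (p : Ω → ℝ) {X : Ω → α} {Y : Ω → β}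
    (h : ∀ ω ω', X ω = X ω' ↔ Y ω = Y ω') : entropy p X = entropy p Y := by
  unfold entropy
  congr 1
  refine Finset.sum_congr rfl fun ω _ => ?_
  rw [law_congr p (fun ω' => h ω' ω)]

theorem entropy_law [Fintype α] [Fintype β] (p : Ω → ℝ) (X : Ω → α) (f : α → β) :
    entropy (law p X) f = entropy p (fun ω => f (X ω)) := by
  simp only [entropy_eq_sum_negMulLog, law_law]

theorem continuous_entropy [Fintype α] (X : Ω → α) :
    Continuous fun p : Ω → ℝ => entropy p X := by
  simp only [entropy_eq_sum_negMulLog]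
  refine continuous_finsetSum _ fun a _ => Real.continuous_negMulLog.comp ?_
  unfold law
  refine continuous_finsetSum _ fun ω _ => ?_
  split_ifs <;> fun_prop

theorem entropy_of_subsingleton [Subsingleton α] {p : Ω → ℝ} (hp : ∑ ω, p ω = 1) (X : Ω → α) :
    entropy p X = 0 := by
  have h (ω) : law p X (X ω) = 1 := by
    rw [← hp]
    unfold law
    exact Finset.sum_congr rfl fun ω' _ => by rw [if_pos (Subsingleton.elim _ _)]
  simp [entropy, h]

/-- The conditional entropy as an expectation over the sample space. -/
theorem condEntropy_eq_sum [Fintype α] [Fintype γ] (p : Ω → ℝ) (X : Ω → α) (Z : Ω → γ) :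
    condEntropy p X Z = -∑ ω, p ω *
      Real.log (law p (fun ω => (X ω, Z ω)) (X ω, Z ω) / law p Z (Z ω)) := by
  unfold condEntropy
  rw [← Fintype.sum_prod_type' (f := fun x z => law p (fun ω => (X ω, Z ω)) (x, z) *
    Real.log (law p (fun ω => (X ω, Z ω)) (x, z) / law p Z z))]
  rw [← sum_law_mul p (fun ω => (X ω, Z ω))
    (fun a => Real.log (law p (fun ω => (X ω, Z ω)) a / law p Z a.2))]

/-- Nonnegativity of `p` lets the logarithm of the quotient split: atoms of positive mass have
positive marginals, and the other atoms contribute nothing. -/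
theorem condEntropy_eq [Fintype α] [Fintype γ] {p : Ω → ℝ} (hp : ∀ ω, 0 ≤ p ω)
    (X : Ω → α) (Z : Ω → γ) :
    condEntropy p X Z = entropy p (fun ω => (X ω, Z ω)) - entropy p Z := by
  rw [condEntropy_eq_sum]
  unfold entropy
  rw [neg_sub_neg, ← Finset.sum_sub_distrib, ← Finset.sum_neg_distrib]
  refine Finset.sum_congr rfl fun ω _ => ?_
  rcases (hp ω).eq_or_lt with h | h
  · simp [← h]
  · rw [Real.log_div (law_pos hp _ h).ne' (law_pos hp _ h).ne']
    ring

theorem condMutualInfo_eq [Fintype α] [Fintype β] [Fintype γ] {p : Ω → ℝ} (hp : ∀ ω, 0 ≤ p ω)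
    (X : Ω → α) (Y : Ω → β) (Z : Ω → γ) :
    condMutualInfo p X Y Z = entropy p (fun ω => (X ω, Z ω)) + entropy p (fun ω => (Y ω, Z ω))
      - entropy p Z - entropy p (fun ω => (X ω, Y ω, Z ω)) := by
  unfold condMutualInfo
  rw [condEntropy_eq hp, condEntropy_eq hp]
  ring

theorem mutualInfo_eq [Fintype α] [Fintype β] {p : Ω → ℝ} (hp : ∀ ω, 0 ≤ p ω)
    (X : Ω → α) (Y : Ω → β) :
    mutualInfo p X Y = entropy p X + entropy p Y - entropy p (fun ω => (X ω, Y ω)) := by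
  unfold mutualInfo entropy
  rw [← Fintype.sum_prod_type' (f := fun x y => law p (fun ω => (X ω, Y ω)) (x, y) *
    Real.log (law p (fun ω => (X ω, Y ω)) (x, y) / (law p X x * law p Y y)))]
  rw [sum_law_mul p (fun ω => (X ω, Y ω))
    (fun a => Real.log (law p (fun ω => (X ω, Y ω)) a / (law p X a.1 * law p Y a.2)))]
  rw [← neg_add, sub_neg_eq_add, neg_add_eq_sub, ← Finset.sum_add_distrib,
    ← Finset.sum_sub_distrib]
  refine Finset.sum_congr rfl fun ω _ => ?_
  rcases (hp ω).eq_or_lt with h | h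
  · simp [← h]
  · have h₁ := (law_pos hp X h).ne'
    have h₂ := (law_pos hp Y h).ne'
    rw [Real.log_div (law_pos hp _ h).ne' (mul_ne_zero h₁ h₂), Real.log_mul h₁ h₂]
    ring

/-- Gibbs' inequality: the conditional entropy is at most the expected code length of any
conditional sub-probability `q`. -/
theorem condEntropy_le_crossEntropy [Fintype α] [Fintype γ] {p : Ω → ℝ} (hp : ∀ ω, 0 ≤ p ω)
    (X : Ω → α) (Z : Ω → γ) (q : γ → α → ℝ) (hq : ∀ z x, 0 ≤ q z x)
    (hpos : ∀ ω, 0 < p ω → 0 < q (Z ω) (X ω)) (hsum : ∀ ω, 0 < p ω → ∑ x, q (Z ω) x ≤ 1) :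
    condEntropy p X Z ≤ -∑ ω, p ω * Real.log (q (Z ω) (X ω)) := by
  classical
  set J : α × γ → ℝ := law p (fun ω => (X ω, Z ω)) with hJ
  have hJ0 : ∀ a, 0 ≤ J a := law_nonneg hp _
  rw [condEntropy_eq_sum, neg_le_neg_iff, ← sub_nonpos, ← Finset.sum_sub_distrib]
  have key : ∀ ω, p ω * Real.log (q (Z ω) (X ω)) -
      p ω * Real.log (J (X ω, Z ω) / law p Z (Z ω)) ≤
      p ω * (q (Z ω) (X ω) * law p Z (Z ω) / J (X ω, Z ω)) - p ω := by
    intro ω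
    rcases (hp ω).eq_or_lt with h | h
    · simp [← h]
    · have h₁ := hpos ω h
      have h₂ : 0 < J (X ω, Z ω) := law_pos hp (fun ω => (X ω, Z ω)) h
      have h₃ := law_pos hp Z h
      -- The inequality `log t ≤ t - 1` at the ratio of `q` to the true conditional law.
      have := Real.log_le_sub_one_of_pos (x := q (Z ω) (X ω) * law p Z (Z ω) / J (X ω, Z ω))
        (by positivity)
      rw [Real.log_div (by positivity) (by positivity), Real.log_mul h₁.ne' h₃.ne'] at this
      rw [Real.log_div h₂.ne' h₃.ne']
      nlinarith
  refine (Finset.sum_le_sum fun ω _ => key ω).trans ?_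
  rw [Finset.sum_sub_distrib,
    ← sum_law_mul p (fun ω => (X ω, Z ω)) (fun a => q a.2 a.1 * law p Z a.2 / J a), sub_nonpos]
  have hZ : ∀ z, (law p Z z) * ∑ x, q z x ≤ law p Z z := by
    intro z
    rcases (law_nonneg hp Z z).eq_or_lt with h | h
    · simp [← h]
    -- `hsum` is available only at values of `Z` of positive mass, so an atom witnessing this is
    -- needed.
    · obtain ⟨ω, -, hω⟩ : ∃ ω ∈ Finset.univ, 0 < if Z ω = z then p ω else 0 := by
        by_contra! hcon
        exact absurd (Finset.sum_nonpos hcon) (not_le.2 h)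
      split_ifs at hω with hz
      · subst hz
        exact mul_le_of_le_one_right h.le (hsum ω hω)
      · exact absurd hω (lt_irrefl _)
  calc ∑ a, J a * (q a.2 a.1 * law p Z a.2 / J a)
      ≤ ∑ a : α × γ, law p Z a.2 * q a.2 a.1 := by
        refine Finset.sum_le_sum fun a _ => ?_
        rcases (hJ0 a).eq_or_lt with h | h
        · rw [← h]
          simpa using mul_nonneg (law_nonneg hp Z a.2) (hq a.2 a.1)
        · apply le_of_eq
          field_simp
    _ = ∑ z, law p Z z * ∑ x, q z x := by
        rw [Fintype.sum_prod_type_right]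
        simp only [Finset.mul_sum]
    _ ≤ ∑ z, law p Z z := Finset.sum_le_sum fun z _ => hZ z
    _ = ∑ ω, p ω := sum_law p Z

theorem sum_law_pair [Fintype α] (p : Ω → ℝ) (X : Ω → α) (Z : Ω → γ) (z : γ) :
    ∑ x, law p (fun ω => (X ω, Z ω)) (x, z) = law p Z z := by
  unfold law
  rw [Finset.sum_comm]
  refine Finset.sum_congr rfl fun ω _ => ?_
  by_cases h : Z ω = z
  · rw [Finset.sum_eq_single (X ω)]
    · simp [h]
    · intro x _ hx
      exact if_neg fun hcon => hx (congrArg Prod.fst hcon).symm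
    · simp
  · rw [if_neg h]
    exact Finset.sum_eq_zero fun x _ => if_neg fun hcon => h (congrArg Prod.snd hcon)

/-- Only an inequality: where `law p Z z = 0` the quotients are `0` by convention. -/
theorem sum_condLaw_le_one [Fintype α] (p : Ω → ℝ) (X : Ω → α) (Z : Ω → γ) (z : γ) :
    ∑ x, law p (fun ω => (X ω, Z ω)) (x, z) / law p Z z ≤ 1 := by
  rw [← Finset.sum_div, sum_law_pair]
  exact div_self_le_one _

/-- Conditioning reduces entropy: if `Z` determines `T`, then `H(X | Z) ≤ H(X | T)`. -/
theorem condEntropy_le_of_determines [Fintype α] [Fintype γ] [Fintype δ] {p : Ω → ℝ}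
    (hp : ∀ ω, 0 ≤ p ω) (X : Ω → α) {Z : Ω → γ} {T : Ω → δ}
    (h : ∀ ω ω', Z ω = Z ω' → T ω = T ω') : condEntropy p X Z ≤ condEntropy p X T := by
  classical
  let J := law p (fun ω => (X ω, T ω))
  -- Adjoining `T` to `Z` changes nothing, and allows the conditional law given `T` as the
  -- competitor in Gibbs' inequality.
  have hcongr : condEntropy p X Z = condEntropy p X (fun ω => (Z ω, T ω)) := by
    rw [condEntropy_eq hp, condEntropy_eq hp]
    congr 1 <;>
    · apply entropy_congr
      intro ω ω'
      simp only [Prod.mk.injEq]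
      have := h ω ω'
      tauto
  rw [hcongr, condEntropy_eq_sum p X T]
  refine condEntropy_le_crossEntropy hp X (fun ω => (Z ω, T ω))
    (fun z x => J (x, z.2) / law p T z.2)
    (fun z x => div_nonneg (law_nonneg hp _ _) (law_nonneg hp _ _))
    (fun ω hω => div_pos (law_pos hp (fun ω => (X ω, T ω)) hω) (law_pos hp T hω))
    (fun ω _ => sum_condLaw_le_one p X T _)

/-- Fano's inequality, for an estimator `g` of `X` from `Z`. -/
theorem fano [Fintype α] [Fintype γ] [DecidableEq α] {p : Ω → ℝ} (hp : ∀ ω, 0 ≤ p ω)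
    (hp₁ : ∑ ω, p ω = 1) (X : Ω → α) (Z : Ω → γ) (g : γ → α) :
    condEntropy p X Z ≤ Real.log 2 +
      (∑ ω, if g (Z ω) ≠ X ω then p ω else 0) * Real.log (Fintype.card α) := by
  rcases isEmpty_or_nonempty Ω with hΩ | ⟨⟨ω₀⟩⟩
  · simp at hp₁
  have : Nonempty α := ⟨X ω₀⟩
  have hc : (0 : ℝ) < Fintype.card α := by exact_mod_cast Fintype.card_pos
  -- The competitor puts mass 1/2 on the estimate and spreads 1/2 uniformly: the cost is `log 2`
  -- always, plus `log card` on errors. Off the estimate only the uniform half counts.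
  refine (condEntropy_le_crossEntropy hp X Z
    (fun z x => if g z = x then 1 / 2 else 1 / 2 * (Fintype.card α : ℝ)⁻¹)
    (fun z x => by positivity) (fun ω _ => by positivity) (fun ω _ => ?_)).trans ?_
  · calc ∑ x, (if g (Z ω) = x then (1 : ℝ) / 2 else 1 / 2 * (Fintype.card α : ℝ)⁻¹)
        ≤ ∑ x, ((if g (Z ω) = x then (1 : ℝ) / 2 else 0) + 1 / 2 * (Fintype.card α : ℝ)⁻¹) := by
          refine Finset.sum_le_sum fun x _ => ?_
          split_ifs
          · have : 0 ≤ 1 / 2 * (Fintype.card α : ℝ)⁻¹ := by positivity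
            linarith
          · simp
      _ = 1 := by
          rw [Finset.sum_add_distrib]
          simp
          field_simp
          norm_num
  · have hlog : Real.log 2 = ∑ ω, Real.log 2 * p ω := by rw [← Finset.mul_sum, hp₁, mul_one]
    rw [hlog, Finset.sum_mul, ← Finset.sum_add_distrib, ← Finset.sum_neg_distrib]
    refine Finset.sum_le_sum fun ω _ => ?_
    by_cases h : g (Z ω) = X ω
    · simp [h]
      linarith
    · simp only [h, if_false, ne_eq, not_false_eq_true, if_true]
      rw [Real.log_mul (by norm_num) (by positivity), Real.log_inv, one_div, Real.log_inv]
      linarith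

/-- Conditional entropy is concave in the law of the pair. -/
theorem sum_condEntropy_le [Fintype α] [Fintype γ] {ι : Type*} [Fintype ι] {c : ℝ} (hc : 0 < c)
    {p : ι → Ω → ℝ} (hp : ∀ i ω, 0 ≤ p i ω) (X : Ω → α) (Z : Ω → γ) :
    ∑ i, c * condEntropy (p i) X Z ≤ condEntropy (fun ω => ∑ i, c * p i ω) X Z := by
  set q : Ω → ℝ := fun ω => ∑ i, c * p i ω with hq
  have hq0 : ∀ ω, 0 ≤ q ω := fun ω => Finset.sum_nonneg fun i _ => mul_nonneg hc.le (hp i ω)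
  have hqpos : ∀ i ω, 0 < p i ω → 0 < q ω := fun i ω h =>
    Finset.sum_pos' (fun i _ => mul_nonneg hc.le (hp i ω)) ⟨i, Finset.mem_univ _, mul_pos hc h⟩
  have key : ∀ i, c * condEntropy (p i) X Z ≤ c * -∑ ω, p i ω *
      Real.log (law q (fun ω => (X ω, Z ω)) (X ω, Z ω) / law q Z (Z ω)) := by
    intro i
    refine mul_le_mul_of_nonneg_left ?_ hc.le
    -- Each component is coded with the conditional law of the mixture; the average cost is then the
    -- conditional entropy of the mixture.
    exact condEntropy_le_crossEntropy (hp i) X Z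
      (fun z x => law q (fun ω => (X ω, Z ω)) (x, z) / law q Z z)
      (fun z x => div_nonneg (law_nonneg hq0 _ _) (law_nonneg hq0 _ _))
      (fun ω hω => div_pos (law_pos hq0 (fun ω => (X ω, Z ω)) (hqpos i ω hω))
        (law_pos hq0 Z (hqpos i ω hω)))
      (fun ω _ => sum_condLaw_le_one q X Z _)
  refine (Finset.sum_le_sum fun i _ => key i).trans (le_of_eq ?_)
  rw [condEntropy_eq_sum]
  simp only [mul_neg, Finset.sum_neg_distrib, neg_inj, Finset.mul_sum]
  rw [Finset.sum_comm]
  refine Finset.sum_congr rfl fun ω _ => ?_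
  rw [hq, Finset.sum_mul]
  exact Finset.sum_congr rfl fun i _ => by ring

end EntropyTheory

/-! ### Products of transition kernels that depend on the past. -/

section CausalProduct

theorem update_eq_of_lt {ζ : Type*} {n : ℕ} {i j : Fin n} (h : j < i) (z : Fin n → ζ) (b : ζ) :
    Function.update z i b j = z j :=
  Function.update_of_ne h.ne _ _

variable {ζ : Type*} [Fintype ζ] {n : ℕ}

/-- Exchanging `z i` with `b` is an involution of the pairs `(z, b)`. -/
theorem sum_sum_update {ι : Type*} [Fintype ι] [DecidableEq ι] (i : ι) (G : (ι → ζ) → ℝ) :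
    ∑ z, ∑ b, G (Function.update z i b) = Fintype.card ζ * ∑ z, G z := by
  let e : ((ι → ζ) × ζ) ≃ ((ι → ζ) × ζ) :=
    { toFun := fun a => (Function.update a.1 i a.2, a.1 i)
      invFun := fun a => (Function.update a.1 i a.2, a.1 i)
      left_inv := fun a => by simp
      right_inv := fun a => by simp }
  rw [← Fintype.sum_prod_type' (f := fun z b => G (Function.update z i b)),
    Fintype.sum_equiv e (fun a => G (Function.update a.1 i a.2)) (fun a => G a.1) (fun a => rfl),
    Fintype.sum_prod_type, Finset.mul_sum]
  simp

/-- Integrating out the coordinate `i`: the rest of the integrand does not depend on it. -/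
theorem sum_mul_eval [Nonempty ζ] {ι : Type*} [Fintype ι] [DecidableEq ι] (i : ι)
    (F : (ι → ζ) → ℝ) (φ : (ι → ζ) → ζ → ℝ)
    (hF : ∀ z b, F (Function.update z i b) = F z)
    (hφ : ∀ z b, φ (Function.update z i b) = φ z) :
    ∑ z, F z * φ z (z i) = ∑ z, F z * (Fintype.card ζ : ℝ)⁻¹ * ∑ b, φ z b := by
  have hc : (Fintype.card ζ : ℝ) ≠ 0 := by exact_mod_cast Fintype.card_ne_zero
  have h := sum_sum_update i (fun z => F z * φ z (z i))
  simp only [hF, hφ, Function.update_self] at h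
  rw [← mul_right_inj' hc, ← h, Finset.mul_sum]
  refine Finset.sum_congr rfl fun z _ => ?_
  rw [← Finset.mul_sum]
  field_simp

/-- The product of the first `j` transition probabilities, the remaining letters being uniform. -/
noncomputable def truncProd (K : Fin n → (Fin n → ζ) → ζ → ℝ) (j : ℕ) (z : Fin n → ζ) : ℝ :=
  ∏ k : Fin n, if (k : ℕ) < j then K k z (z k) else (Fintype.card ζ : ℝ)⁻¹

/-- All factors of `truncProd` except the one at `i`, when `j` is `i` or `i + 1`. -/
noncomputable def truncRest (K : Fin n → (Fin n → ζ) → ζ → ℝ) (i : Fin n) (z : Fin n → ζ) : ℝ :=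
  ∏ k ∈ Finset.univ.erase i, if k < i then K k z (z k) else (Fintype.card ζ : ℝ)⁻¹

theorem truncProd_self (K : Fin n → (Fin n → ζ) → ζ → ℝ) (i : Fin n) (z : Fin n → ζ) :
    truncProd K i z = truncRest K i z * (Fintype.card ζ : ℝ)⁻¹ := by
  unfold truncProd truncRest
  rw [← Finset.prod_erase_mul _ _ (Finset.mem_univ i)]
  simp

theorem truncProd_succ (K : Fin n → (Fin n → ζ) → ζ → ℝ) (i : Fin n) (z : Fin n → ζ) :
    truncProd K (i + 1) z = truncRest K i z * K i z (z i) := by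
  unfold truncProd truncRest
  rw [← Finset.prod_erase_mul _ _ (Finset.mem_univ i)]
  simp only [Nat.lt_add_one, if_true]
  congr 1
  refine Finset.prod_congr rfl fun k hk => ?_
  have hki : (k : ℕ) ≠ i := fun h => (Finset.mem_erase.1 hk).1 (Fin.ext h)
  by_cases h : k < i
  · rw [if_pos h, if_pos (by have := Fin.lt_def.1 h; omega)]
  · rw [if_neg h, if_neg (by rw [Fin.lt_def] at h; omega)]

theorem truncProd_all (K : Fin n → (Fin n → ζ) → ζ → ℝ) (z : Fin n → ζ) :
    truncProd K n z = ∏ k, K k z (z k) := by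
  simp [truncProd]

variable {K : Fin n → (Fin n → ζ) → ζ → ℝ}

theorem truncRest_update (hK : ∀ k z z', (∀ j < k, z j = z' j) → K k z = K k z')
    (i : Fin n) (z : Fin n → ζ) (b : ζ) :
    truncRest K i (Function.update z i b) = truncRest K i z := by
  unfold truncRest
  refine Finset.prod_congr rfl fun k _ => ?_
  split_ifs with h
  · rw [hK k _ z fun j hj => update_eq_of_lt (hj.trans h) z b, update_eq_of_lt h]
  · rfl

/-- The truncations at `i` and `i + 1` share `truncRest`, which ignores coordinate `i`: earlier
kernels are causal and later factors constant. So that coordinate integrates out. -/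
theorem sum_mul_truncProd_succ [Nonempty ζ]
    (hK : ∀ k z z', (∀ j < k, z j = z' j) → K k z = K k z') (i : Fin n)
    (F : (Fin n → ζ) → ζ → ℝ) (hF : ∀ z z', (∀ j < i, z j = z' j) → F z = F z') :
    ∑ z, truncProd K (i + 1) z * F z (z i) =
      ∑ z, truncProd K i z * ∑ b, K i z b * F z b := by
  simp only [truncProd_succ, truncProd_self, mul_assoc _ (K i _ _) _]
  exact sum_mul_eval i (truncRest K i) (fun z b => K i z b * F z b) (truncRest_update hK i)
    fun z b => by
      rw [hK i _ z fun j hj => update_eq_of_lt hj z b, hF _ z fun j hj => update_eq_of_lt hj z b]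

/-- Kernels past the horizon `j` of `F` have total mass one, so they may be replaced by uniform
factors one at a time. -/
theorem sum_mul_truncProd_of_le [Nonempty ζ]
    (hK : ∀ k z z', (∀ j < k, z j = z' j) → K k z = K k z') (hK₁ : ∀ k z, ∑ b, K k z b = 1)
    {j : ℕ} (F : (Fin n → ζ) → ℝ)
    (hF : ∀ z z', (∀ k : Fin n, (k : ℕ) < j → z k = z' k) → F z = F z') {i : ℕ} (hji : j ≤ i)
    (hin : i ≤ n) : ∑ z, truncProd K i z * F z = ∑ z, truncProd K j z * F z := by
  induction i, hji using Nat.le_induction with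
  | base => rfl
  | succ i hji ih =>
    rw [← ih (by omega)]
    have h := sum_mul_truncProd_succ hK ⟨i, hin⟩ (fun z _ => F z)
      (fun z z' h => funext fun _ => hF z z' fun k hk => h k (Fin.lt_def.2 (by simp; omega)))
    simpa [← Finset.sum_mul, hK₁] using h

theorem sum_causalProd [Nonempty ζ]
    (hK : ∀ k z z', (∀ j < k, z j = z' j) → K k z = K k z') (hK₁ : ∀ k z, ∑ b, K k z b = 1) :
    ∑ z, ∏ k, K k z (z k) = 1 := by
  have h := sum_mul_truncProd_of_le hK hK₁ (j := 0) (fun _ => 1) (fun _ _ _ => rfl)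
    (Nat.zero_le n) le_rfl
  simp only [mul_one, truncProd_all] at h
  rw [h]
  simp [truncProd]

/-- Given the past, the letter at time `k` has law `K k`. -/
theorem sum_causalProd_mul [Nonempty ζ]
    (hK : ∀ k z z', (∀ j < k, z j = z' j) → K k z = K k z') (hK₁ : ∀ k z, ∑ b, K k z b = 1)
    (k : Fin n) (F : (Fin n → ζ) → ζ → ℝ) (hF : ∀ z z', (∀ j < k, z j = z' j) → F z = F z') :
    ∑ z, (∏ i, K i z (z i)) * F z (z k) =
      ∑ z, (∏ i, K i z (z i)) * ∑ b, K k z b * F z b := by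
  simp only [← truncProd_all]
  -- Truncate just after time `k`, integrate out the letter at `k`, then restore the full product.
  rw [sum_mul_truncProd_of_le hK hK₁ (j := k + 1) (fun z => F z (z k)) ?_ k.isLt le_rfl,
    sum_mul_truncProd_succ hK k F hF,
    sum_mul_truncProd_of_le hK hK₁ (j := k) (fun z => ∑ b, K k z b * F z b) ?_ k.isLt.le le_rfl]
  · intro z z' h
    rw [hK k z z' fun j hj => h j (Fin.lt_def.1 hj), hF z z' fun j hj => h j (Fin.lt_def.1 hj)]
  · intro z z' h
    rw [hF z z' fun j hj => h j (by have := Fin.lt_def.1 hj; omega), h k (Nat.lt_add_one _)]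

end CausalProduct

/-! ### Laws and entropies of i.i.d. sequences. -/

section Iid

variable {σ : Type*} [Fintype σ] {m : ℕ}

theorem sum_prod_mul_eval {p : σ → ℝ} (hp : ∑ a, p a = 1) (i : Fin m) (f : σ → ℝ) :
    ∑ s : Fin m → σ, (∏ j, p (s j)) * f (s i) = ∑ a, p a * f a := by
  classical
  have h := (Finset.prod_univ_sum (fun _ : Fin m => (Finset.univ : Finset σ))
    (fun j a => p a * if j = i then f a else 1)).symm
  rw [Fintype.piFinset_univ] at h
  simp only [Finset.prod_mul_distrib] at h
  simp only [Finset.prod_ite_eq', Finset.mem_univ, if_true] at h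
  rw [h, Finset.prod_eq_single i]
  · simp
  · intro j _ hj
    simpa [hj] using hp
  · simp

theorem law_iid (p : σ → ℝ) {α : Type*} (F : σ → α) (a : Fin m → α) :
    law (fun s : Fin m → σ => ∏ j, p (s j)) (fun s i => F (s i)) a = ∏ i, law p F (a i) := by
  classical
  have h := Finset.prod_univ_sum (fun _ : Fin m => (Finset.univ : Finset σ))
    (fun j b => if F b = a j then p b else 0)
  rw [Fintype.piFinset_univ] at h
  unfold law
  convert h.symm using 2 with s
  rw [Finset.prod_ite_zero]
  simp [funext_iff]

theorem sum_iid {p : σ → ℝ} (hp : ∑ a, p a = 1) : ∑ s : Fin m → σ, ∏ j, p (s j) = 1 := by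
  classical
  have h := Finset.prod_univ_sum (fun _ : Fin m => (Finset.univ : Finset σ))
    (fun _ b => p b)
  rw [Fintype.piFinset_univ] at h
  rw [← h]
  simp [hp]

theorem entropy_iid {p : σ → ℝ} (hp0 : ∀ a, 0 ≤ p a) (hp : ∑ a, p a = 1) {α : Type*} (F : σ → α) :
    entropy (fun s : Fin m → σ => ∏ j, p (s j)) (fun s i => F (s i)) = m * entropy p F := by
  have h (s : Fin m → σ) : (∏ j, p (s j)) * Real.log (∏ i, law p F (F (s i))) =
      ∑ i, (∏ j, p (s j)) * Real.log (law p F (F (s i))) := by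
    -- The logarithm of the product splits only when no factor vanishes; sequences of mass zero are
    -- set aside.
    by_cases h0 : ∏ j, p (s j) = 0
    · simp [h0]
    · rw [Real.log_prod, Finset.mul_sum]
      intro i hi
      exact (law_pos hp0 F ((hp0 _).lt_of_ne' (Finset.prod_ne_zero_iff.1 h0 i hi))).ne'
  unfold entropy
  simp only [law_iid, h]
  rw [Finset.sum_comm]
  simp only [sum_prod_mul_eval hp _ (fun a => Real.log (law p F (F a)))]
  simp

end Iid

/-! ### The chain rule. -/

section Chain

variable {Ω ν τ : Type*} [Fintype Ω] [Fintype ν] [Fintype τ] {n : ℕ}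

/-- The chain rule for conditional entropy. -/
theorem condEntropy_pi {p : Ω → ℝ} (hp : ∀ ω, 0 ≤ p ω) (V : Fin n → Ω → ν) (T : Ω → τ) :
    condEntropy p (fun ω k => V k ω) T =
      ∑ k, condEntropy p (V k) (fun ω => ((fun j : {j : Fin n // (j : ℕ) < k} => V j ω), T ω)) := by
  classical
  -- The joint entropy of `T` and the first `i` letters; the sum of conditional entropies telescopes
  -- in it.
  let H : ℕ → ℝ := fun i =>
    entropy p (fun ω => ((fun j : {j : Fin n // (j : ℕ) < i} => V j ω), T ω))
  have hk (k : Fin n) : condEntropy p (V k)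
      (fun ω => ((fun j : {j : Fin n // (j : ℕ) < k} => V j ω), T ω)) = H (k + 1) - H k := by
    rw [condEntropy_eq hp]
    congr 1
    apply entropy_congr
    intro ω ω'
    simp only [Prod.mk.injEq, funext_iff, Subtype.forall]
    constructor
    · rintro ⟨h₁, h₂, h₃⟩
      refine ⟨fun j hj => ?_, h₃⟩
      rcases Nat.lt_succ_iff_lt_or_eq.1 hj with h | h
      · exact h₂ j h
      · rw [Fin.ext h, h₁]
    · rintro ⟨h₁, h₂⟩
      exact ⟨h₁ k (Nat.lt_add_one _), fun j hj => h₁ j (hj.trans (Nat.lt_add_one _)), h₂⟩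
  simp only [hk]
  rw [Fin.sum_univ_eq_sum_range (fun i => H (i + 1) - H i), Finset.sum_range_sub,
    condEntropy_eq hp]
  congr 1 <;>
  · apply entropy_congr
    intro ω ω'
    simp [funext_iff]

end Chain

/-! ### Memoryless channels with causal inputs, and the single-letter converse. -/

section MemorylessChannel

variable {σ ζ ξ : Type*} [Fintype σ] [Fintype ζ] {m n : ℕ}

/-- The joint law of an i.i.d. source sequence `s` and the outputs `z` of a memoryless channel with
inputs `x k s z`. -/
def processLaw (src : σ → ℝ) (chan : ξ → ζ → ℝ) (x : Fin n → (Fin m → σ) → (Fin n → ζ) → ξ)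
    (ω : (Fin m → σ) × (Fin n → ζ)) : ℝ :=
  (∏ i, src (ω.1 i)) * ∏ k, chan (x k ω.1 ω.2) (ω.2 k)

/-- The law of the input and the output of a channel with input law `p`. -/
def pairLaw (chan : ξ → ζ → ℝ) (p : ξ → ℝ) (a : ξ × ζ) : ℝ := p a.1 * chan a.1 a.2

/-- The channel inputs at time `k` depend on the earlier outputs only. -/
def CausalInput (x : Fin n → (Fin m → σ) → (Fin n → ζ) → ξ) : Prop :=
  ∀ k s z z', (∀ j < k, z j = z' j) → x k s z = x k s z'

variable {src : σ → ℝ} {chan : ξ → ζ → ℝ} {x : Fin n → (Fin m → σ) → (Fin n → ζ) → ξ}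

theorem processLaw_nonneg (hs : src ∈ stdSimplex ℝ σ) (hc : ∀ a, chan a ∈ stdSimplex ℝ ζ)
    (ω : (Fin m → σ) × (Fin n → ζ)) : 0 ≤ processLaw src chan x ω :=
  mul_nonneg (Finset.prod_nonneg fun _ _ => hs.1 _) (Finset.prod_nonneg fun _ _ => (hc _).1 _)

/-- For fixed `s` the outputs form a causal product with kernels `chan (x k s z)`, so
`sum_causalProd_mul` applies. -/
theorem sum_processLaw_mul [Nonempty ζ] (hc : ∀ a, chan a ∈ stdSimplex ℝ ζ) (hx : CausalInput x)
    (k : Fin n) (F : (Fin m → σ) → (Fin n → ζ) → ζ → ℝ)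
    (hF : ∀ s z z', (∀ j < k, z j = z' j) → F s z = F s z') :
    ∑ ω, processLaw src chan x ω * F ω.1 ω.2 (ω.2 k) =
      ∑ ω, processLaw src chan x ω * ∑ b, chan (x k ω.1 ω.2) b * F ω.1 ω.2 b := by
  rw [Fintype.sum_prod_type, Fintype.sum_prod_type]
  refine Finset.sum_congr rfl fun s _ => ?_
  simp only [processLaw, mul_assoc, ← Finset.mul_sum]
  congr 1
  exact sum_causalProd_mul (K := fun k z => chan (x k s z))
    (fun k z z' h => by simp only [hx k s z z' h]) (fun k z => (hc _).2) k (F s) (hF s)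

theorem sum_processLaw_mul_fst [Nonempty ζ] (hc : ∀ a, chan a ∈ stdSimplex ℝ ζ)
    (hx : CausalInput x) (f : (Fin m → σ) → ℝ) :
    ∑ ω, processLaw src chan x ω * f ω.1 = ∑ s, (∏ i, src (s i)) * f s := by
  rw [Fintype.sum_prod_type]
  refine Finset.sum_congr rfl fun s _ => ?_
  simp only [processLaw]
  rw [← Finset.sum_mul, ← Finset.mul_sum]
  have h := sum_causalProd (K := fun k z => chan (x k s z))
    (fun k z z' h => by simp only [hx k s z z' h]) (fun k z => (hc _).2)
  rw [h, mul_one]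

theorem sum_processLaw [Nonempty ζ] (hs : src ∈ stdSimplex ℝ σ)
    (hc : ∀ a, chan a ∈ stdSimplex ℝ ζ) (hx : CausalInput x) :
    ∑ ω, processLaw src chan x ω = 1 := by
  have h := sum_processLaw_mul_fst (src := src) hc hx (fun _ => 1)
  simpa [sum_iid hs.2] using h

theorem law_processLaw_fst [Nonempty ζ] (hc : ∀ a, chan a ∈ stdSimplex ℝ ζ)
    (hx : CausalInput x) (s : Fin m → σ) :
    law (processLaw src chan x) Prod.fst s = ∏ i, src (s i) := by
  classical
  have h := sum_processLaw_mul_fst (src := src) hc hx (fun s' => if s' = s then 1 else 0)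
  simp only [mul_ite, mul_one, mul_zero, Finset.sum_ite_eq', Finset.mem_univ, if_true] at h
  rw [← h]
  unfold law
  exact Finset.sum_congr rfl fun ω _ => by congr 1

theorem entropy_processLaw_source [Nonempty ζ] (hs : src ∈ stdSimplex ℝ σ)
    (hc : ∀ a, chan a ∈ stdSimplex ℝ ζ) (hx : CausalInput x) {α : Type*} [Fintype α] (A : σ → α) :
    entropy (processLaw src chan x) (fun ω i => A (ω.1 i)) = m * entropy src A := by
  rw [← entropy_iid hs.1 hs.2,
    ← entropy_law (processLaw src chan x) Prod.fst (fun (s : Fin m → σ) i => A (s i))]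
  congr 1
  exact funext fun s => law_processLaw_fst hc hx s

variable {α ν υ : Type*}

/-- The channel is memoryless: given `A`, which is a function of the past and determines the input
at time `k`, the output at time `k` has the law given by the channel. -/
theorem law_output_past [Nonempty ζ] (hc : ∀ a, chan a ∈ stdSimplex ℝ ζ)
    (hx : CausalInput x) (k : Fin n) (o : ζ → ν) (A : (Fin m → σ) × (Fin n → ζ) → α)
    (hA : ∀ s z z', (∀ j < k, z j = z' j) → A (s, z) = A (s, z'))
    (hAx : ∀ ω ω', A ω = A ω' → x k ω.1 ω.2 = x k ω'.1 ω'.2)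
    (v : ν) (ω : (Fin m → σ) × (Fin n → ζ)) :
    law (processLaw src chan x) (fun ω => (o (ω.2 k), A ω)) (v, A ω) =
      law (chan (x k ω.1 ω.2)) o v * law (processLaw src chan x) A (A ω) := by
  classical
  have h := sum_processLaw_mul (src := src) hc hx k
    (fun s z b => if o b = v ∧ A (s, z) = A ω then 1 else 0)
    (fun s z z' h => by simp only [hA s z z' h])
  simp only [law, Prod.mk.injEq]
  simp only [mul_ite, mul_one, mul_zero, Prod.mk.eta] at h
  rw [Finset.mul_sum]
  refine Eq.trans ?_ (h.trans ?_)
  · refine Finset.sum_congr rfl fun ω' _ => ?_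
    congr 1
  · refine Finset.sum_congr rfl fun ω' _ => ?_
    by_cases hω : A ω' = A ω
    · simp only [hω, hAx ω' ω hω, and_true, if_true]
      rw [mul_comm]
    · simp [hω]

/-- The right-hand side does not involve `A`: conditioning on the whole past or on the current input
alone gives the same entropy. -/
theorem condEntropy_output_past [Nonempty ζ] [Fintype α] [Fintype ν] (hs : src ∈ stdSimplex ℝ σ)
    (hc : ∀ a, chan a ∈ stdSimplex ℝ ζ)
    (hx : CausalInput x) (k : Fin n) (o : ζ → ν) (A : (Fin m → σ) × (Fin n → ζ) → α)
    (hA : ∀ s z z', (∀ j < k, z j = z' j) → A (s, z) = A (s, z'))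
    (hAx : ∀ ω ω', A ω = A ω' → x k ω.1 ω.2 = x k ω'.1 ω'.2) :
    condEntropy (processLaw src chan x) (fun ω => o (ω.2 k)) A =
      -∑ ω, processLaw src chan x ω * Real.log (law (chan (x k ω.1 ω.2)) o (o (ω.2 k))) := by
  rw [condEntropy_eq_sum]
  congr 1
  refine Finset.sum_congr rfl fun ω _ => ?_
  have h0 := processLaw_nonneg (x := x) hs hc
  rcases (h0 ω).eq_or_lt with h | h
  · simp [← h]
  · rw [law_output_past hc hx k o A hA hAx, mul_div_cancel_right₀ _ (law_pos h0 A h).ne']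

theorem pairLaw_nonneg (hc : ∀ a, chan a ∈ stdSimplex ℝ ζ) {p : ξ → ℝ} (hp : ∀ a, 0 ≤ p a)
    (a : ξ × ζ) : 0 ≤ pairLaw chan p a := mul_nonneg (hp _) ((hc _).1 _)

/-- Since the channel is the same at every time, averaging these laws over `k` averages only the
input law. -/
theorem law_input_output [Nonempty ζ] (hc : ∀ a, chan a ∈ stdSimplex ℝ ζ)
    (hx : CausalInput x) (k : Fin n) :
    law (processLaw src chan x) (fun ω => (x k ω.1 ω.2, ω.2 k)) =
      pairLaw chan (law (processLaw src chan x) (fun ω => x k ω.1 ω.2)) := by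
  classical
  funext ⟨a, b⟩
  have h := sum_processLaw_mul (src := src) hc hx k
    (fun s z b' => if x k s z = a ∧ b' = b then 1 else 0)
    (fun s z z' h => by simp only [hx k s z z' h])
  simp only [mul_ite, mul_one, mul_zero] at h
  simp only [law, Prod.mk.injEq, pairLaw, Finset.sum_mul]
  refine Eq.trans ?_ (h.trans ?_)
  · refine Finset.sum_congr rfl fun ω _ => ?_
    congr 1
  · refine Finset.sum_congr rfl fun ω _ => ?_
    by_cases hω : x k ω.1 ω.2 = a <;> simp [hω]

/-- The time average of the laws of the channel inputs. -/
noncomputable def avgInput (src : σ → ℝ) (chan : ξ → ζ → ℝ)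
    (x : Fin n → (Fin m → σ) → (Fin n → ζ) → ξ) (a : ξ) : ℝ :=
  ∑ k, (n : ℝ)⁻¹ * law (processLaw src chan x) (fun ω => x k ω.1 ω.2) a

theorem pairLaw_avgInput [Nonempty ζ] (hc : ∀ a, chan a ∈ stdSimplex ℝ ζ) (hx : CausalInput x) :
    pairLaw chan (avgInput src chan x) = fun a => ∑ k, (n : ℝ)⁻¹ *
      law (processLaw src chan x) (fun ω => (x k ω.1 ω.2, ω.2 k)) a := by
  funext a
  simp only [law_input_output hc hx, pairLaw, avgInput, Finset.sum_mul, mul_assoc]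

variable [Fintype ξ]

theorem law_pairLaw_fst (hc : ∀ a, chan a ∈ stdSimplex ℝ ζ) (p : ξ → ℝ) (a : ξ) :
    law (pairLaw chan p) Prod.fst a = p a := by
  classical
  unfold law pairLaw
  rw [Fintype.sum_prod_type, Finset.sum_eq_single a]
  · simp [← Finset.mul_sum, (hc a).2]
  · intro b _ hb
    simp [hb]
  · simp

/-- Given the input, the output law is that of the channel whatever `p` is. Hence this entropy is
linear in `p`, as time averaging requires. -/
theorem condEntropy_pairLaw [Fintype ν] (hc : ∀ a, chan a ∈ stdSimplex ℝ ζ) {p : ξ → ℝ}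
    (hp : ∀ a, 0 ≤ p a) (o : ζ → ν) :
    condEntropy (pairLaw chan p) (fun a => o a.2) Prod.fst =
      -∑ a, pairLaw chan p a * Real.log (law (chan a.1) o (o a.2)) := by
  classical
  rw [condEntropy_eq_sum]
  congr 1
  refine Finset.sum_congr rfl fun a _ => ?_
  rcases (hp a.1).eq_or_lt with h | h
  · simp [pairLaw, ← h]
  · have : law (pairLaw chan p) (fun a => (o a.2, a.1)) (o a.2, a.1) =
        p a.1 * law (chan a.1) o (o a.2) := by
      unfold law pairLaw
      rw [Fintype.sum_prod_type, Finset.sum_eq_single a.1]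
      · simp [Finset.mul_sum]
      · intro b _ hb
        simp [hb]
      · simp
    rw [this, law_pairLaw_fst hc, mul_div_cancel_left₀ _ h.ne']

theorem avgInput_mem [Nonempty ζ] (hs : src ∈ stdSimplex ℝ σ) (hc : ∀ a, chan a ∈ stdSimplex ℝ ζ)
    (hx : CausalInput x) (hn : 0 < n) : avgInput src chan x ∈ stdSimplex ℝ ξ := by
  refine ⟨fun a => Finset.sum_nonneg fun k _ => mul_nonneg (by positivity)
    (law_nonneg (processLaw_nonneg hs hc) _ _), ?_⟩
  unfold avgInput
  rw [Finset.sum_comm]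
  simp only [← Finset.mul_sum, sum_law, sum_processLaw hs hc hx]
  have : (n : ℝ) ≠ 0 := by positivity
  simp [this]

/-- The difference `H(o(Z) | u(X)) - H(o(Z) | X)`, which is `I(X; o(Z) | u(X))`, for the input law
`p`. -/
noncomputable def infoRate (chan : ξ → ζ → ℝ) (o : ζ → ν) (u : ξ → υ) [Fintype ν] [Fintype υ]
    (p : ξ → ℝ) : ℝ :=
  condEntropy (pairLaw chan p) (fun a => o a.2) (fun a => u a.1) -
    condEntropy (pairLaw chan p) (fun a => o a.2) Prod.fst

theorem infoRate_nonneg [Fintype ν] [Fintype υ] (hc : ∀ a, chan a ∈ stdSimplex ℝ ζ)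
    (o : ζ → ν) (u : ξ → υ) {p : ξ → ℝ} (hp : ∀ a, 0 ≤ p a) : 0 ≤ infoRate chan o u p :=
  sub_nonneg.2 (condEntropy_le_of_determines (pairLaw_nonneg hc hp) _
    fun _ _ h => congrArg u h)

/-- Averaging increases the first entropy, by concavity, and preserves the second, by linearity. -/
theorem sum_infoRate_le [Nonempty ζ] [Fintype ν] [Fintype υ] (hs : src ∈ stdSimplex ℝ σ)
    (hc : ∀ a, chan a ∈ stdSimplex ℝ ζ) (hx : CausalInput x) (hn : 0 < n)
    (o : ζ → ν) (u : ξ → υ) :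
    ∑ k, (condEntropy (processLaw src chan x) (fun ω => o (ω.2 k)) (fun ω => u (x k ω.1 ω.2)) -
      condEntropy (processLaw src chan x) (fun ω => o (ω.2 k)) (fun ω => x k ω.1 ω.2)) ≤
      n * infoRate chan o u (avgInput src chan x) := by
  have hP := processLaw_nonneg (x := x) hs hc
  set Q : Fin n → ξ × ζ → ℝ := fun k =>
    law (processLaw src chan x) (fun ω => (x k ω.1 ω.2, ω.2 k)) with hQ
  have hQ0 : ∀ k a, 0 ≤ Q k a := fun k a => law_nonneg hP _ _
  have hn' : (0 : ℝ) < n := by exact_mod_cast hn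
  have hu (k : Fin n) :
      condEntropy (processLaw src chan x) (fun ω => o (ω.2 k)) (fun ω => u (x k ω.1 ω.2)) =
        condEntropy (Q k) (fun a => o a.2) (fun a => u a.1) := by
    rw [condEntropy_eq hP, condEntropy_eq (hQ0 k), hQ]
    simp only [entropy_law]
  have hid (k : Fin n) :
      condEntropy (processLaw src chan x) (fun ω => o (ω.2 k)) (fun ω => x k ω.1 ω.2) =
        condEntropy (Q k) (fun a => o a.2) Prod.fst := by
    rw [condEntropy_eq hP, condEntropy_eq (hQ0 k), hQ]
    simp only [entropy_law]
  have h₁ := sum_condEntropy_le (inv_pos.2 hn') hQ0 (fun a => o a.2) (fun a => u a.1)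
  have h₂ : ∑ k, (n : ℝ)⁻¹ * condEntropy (Q k) (fun a => o a.2) Prod.fst =
      condEntropy (pairLaw chan (avgInput src chan x)) (fun a => o a.2) Prod.fst := by
    rw [condEntropy_pairLaw hc (avgInput_mem hs hc hx hn).1]
    simp only [hQ, law_input_output hc hx]
    simp only [condEntropy_pairLaw hc (fun a => law_nonneg hP _ a), mul_neg,
      Finset.sum_neg_distrib, Finset.mul_sum]
    rw [Finset.sum_comm]
    congr 1
    refine Finset.sum_congr rfl fun a _ => ?_
    simp only [pairLaw, avgInput, Finset.sum_mul, mul_assoc]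
  rw [← pairLaw_avgInput hc hx] at h₁
  rw [infoRate, ← h₂, ← inv_mul_le_iff₀ hn', Finset.mul_sum]
  simp only [hu, hid, mul_sub, Finset.sum_sub_distrib]
  exact sub_le_sub_right h₁ _

open Classical in
/-- The single-letter converse: if a decoder recovers the source component `A` from the side
information `B` and the channel output components `o`, with error probability at most `ε`, and the
input component `u` is a function of `B` and the past of `o`, then `H(A | B)` is bounded by the
information rate at the averaged input law. -/
theorem converse [Nonempty ζ] (hs : src ∈ stdSimplex ℝ σ)
    (hc : ∀ a, chan a ∈ stdSimplex ℝ ζ) (hx : CausalInput x) (hn : 0 < n)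
    {β : Type*} [Fintype α] [Fintype β] [Fintype ν] [Fintype υ]
    (A : σ → α) (B : σ → β) (o : ζ → ν) (u : ξ → υ)
    (hu : ∀ k s s' z z', (∀ i, B (s i) = B (s' i)) → (∀ j < k, o (z j) = o (z' j)) →
      u (x k s z) = u (x k s' z'))
    (dec : (Fin m → β) → (Fin n → ν) → Fin m → α) {ε : ℝ}
    (hdec : (∑ ω, if dec (fun i => B (ω.1 i)) (fun k => o (ω.2 k)) ≠ (fun i => A (ω.1 i)) then
      processLaw src chan x ω else 0) ≤ ε) :
    m * condEntropy src A B ≤ n * infoRate chan o u (avgInput src chan x) + Real.log 2 +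
      ε * (m * Real.log (Fintype.card α)) := by
  set P := processLaw src chan x
  have hP : ∀ ω, 0 ≤ P ω := processLaw_nonneg (x := x) hs hc
  set Am : (Fin m → σ) × (Fin n → ζ) → Fin m → α := fun ω i => A (ω.1 i) with hAm
  set Bm : (Fin m → σ) × (Fin n → ζ) → Fin m → β := fun ω i => B (ω.1 i) with hBm
  set V : (Fin m → σ) × (Fin n → ζ) → Fin n → ν := fun ω k => o (ω.2 k) with hV
  have hsource : m * condEntropy src A B = condEntropy P Am Bm := by
    rw [condEntropy_eq hs.1, condEntropy_eq hP, mul_sub,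
      ← entropy_processLaw_source hs hc hx B,
      ← entropy_processLaw_source hs hc hx (fun a => (A a, B a))]
    congr 1
    apply entropy_congr
    intro ω ω'
    simp [hAm, hBm, funext_iff, forall_and]
  have hfano : condEntropy P Am (fun ω => (Bm ω, V ω)) ≤
      Real.log 2 + ε * (m * Real.log (Fintype.card α)) := by
    refine (fano hP (sum_processLaw hs hc hx) Am (fun ω => (Bm ω, V ω))
      (fun a => dec a.1 a.2)).trans ?_
    rw [Fintype.card_fun, Fintype.card_fin, Nat.cast_pow, Real.log_pow]
    have h0 : 0 ≤ (m : ℝ) * Real.log (Fintype.card α) :=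
      mul_nonneg (Nat.cast_nonneg _) (Real.log_natCast_nonneg _)
    have := mul_le_mul_of_nonneg_right hdec h0
    linarith
  -- Two expansions of the joint entropy of `Am`, `Bm` and `V`.
  have hsplit : condEntropy P Am Bm = condEntropy P V Bm - condEntropy P V (fun ω => (Am ω, Bm ω))
      + condEntropy P Am (fun ω => (Bm ω, V ω)) := by
    rw [condEntropy_eq hP, condEntropy_eq hP, condEntropy_eq hP, condEntropy_eq hP]
    have h₁ : entropy P (fun ω => (V ω, Bm ω)) = entropy P (fun ω => (Bm ω, V ω)) :=
      entropy_congr P fun ω ω' => by simp only [Prod.mk.injEq]; tauto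
    have h₂ : entropy P (fun ω => (V ω, Am ω, Bm ω)) = entropy P (fun ω => (Am ω, Bm ω, V ω)) :=
      entropy_congr P fun ω ω' => by simp only [Prod.mk.injEq]; tauto
    rw [h₁, h₂]
    ring
  have hupper : condEntropy P V Bm ≤
      ∑ k, condEntropy P (fun ω => o (ω.2 k)) (fun ω => u (x k ω.1 ω.2)) := by
    rw [hV, condEntropy_pi hP (fun k ω => o (ω.2 k))]
    refine Finset.sum_le_sum fun k _ => condEntropy_le_of_determines hP _ fun ω ω' h => ?_
    simp only [Prod.mk.injEq, funext_iff, Subtype.forall] at h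
    exact hu k _ _ _ _ h.2 fun j hj => h.1 j hj
  have hlower : ∑ k, condEntropy P (fun ω => o (ω.2 k)) (fun ω => x k ω.1 ω.2) ≤
      condEntropy P V (fun ω => (Am ω, Bm ω)) := by
    rw [hV, condEntropy_pi hP (fun k ω => o (ω.2 k))]
    refine Finset.sum_le_sum fun k _ => ?_
    -- The past keeps the full outputs rather than `o` of them: the input at time `k` may depend on
    -- components that `o` discards, as the relay input does when `o` is the destination output.
    let past : (Fin m → σ) × (Fin n → ζ) → (Fin m → σ) × ({j : Fin n // j < k} → ζ) :=
      fun ω => (ω.1, fun j => ω.2 j)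
    rw [condEntropy_output_past hs hc hx k o (fun ω => x k ω.1 ω.2) (fun s z z' h => hx k s z z' h)
      (fun _ _ h => h), ← condEntropy_output_past hs hc hx k o past]
    · refine condEntropy_le_of_determines hP _ fun ω ω' h => ?_
      simp only [past, Prod.mk.injEq, funext_iff, Subtype.forall] at h ⊢
      exact ⟨fun j hj => congrArg o (h.2 j hj), fun i => by simp [hAm, h.1],
        fun i => by simp [hBm, h.1]⟩
    · intro s z z' h
      simp only [past, Prod.mk.injEq, true_and]
      exact funext fun j => h j j.2
    · rintro ⟨s, z⟩ ⟨s', z'⟩ h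
      simp only [past, Prod.mk.injEq, funext_iff, Subtype.forall] at h
      obtain rfl : s = s' := funext h.1
      exact hx k s z z' h.2
  have hrate := sum_infoRate_le hs hc hx hn o u
  rw [Finset.sum_sub_distrib] at hrate
  linarith

end MemorylessChannel

/-! ### Codes as causal inputs, information rates as mutual informations, and compactness. -/

section Setup

variable {S₁ S₂ W W₃ X₁ X₂ X₃ Y Y₃ : Type*}
theorem Code.relayInput_congr {m n : ℕ} (c : Code S₁ S₂ W W₃ X₁ X₂ X₃ Y Y₃ m n) (k : Fin n)
    (w₃ : Fin m → W₃) {y y' : Fin n → Y₃} (h : ∀ j < k, y j = y' j) :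
    c.relayInput y w₃ k = c.relayInput y' w₃ k := by
  unfold Code.relayInput
  congr 1
  exact funext fun j => h _ (Fin.lt_def.2 j.isLt)

/-- The channel inputs at time `k` as a function of the sources and of the channel outputs. -/
def Code.input {m n : ℕ} (c : Code S₁ S₂ W W₃ X₁ X₂ X₃ Y Y₃ m n) (k : Fin n)
    (s : Fin m → S₁ × S₂ × W × W₃) (z : Fin n → Y × Y₃) : X₁ × X₂ × X₃ :=
  (c.f₁ (fun i => rvS₁ (s i)) k, c.f₂ (fun i => rvS₂ (s i)) k,
    c.relayInput (fun j => (z j).2) (fun i => rvW₃ (s i)) k)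

theorem Code.causalInput {m n : ℕ} (c : Code S₁ S₂ W W₃ X₁ X₂ X₃ Y Y₃ m n) :
    CausalInput c.input := by
  intro k s z z' h
  unfold Code.input
  rw [c.relayInput_congr k _ fun j hj => by rw [h j hj]]

variable [Fintype S₁] [Fintype S₂] [Fintype W] [Fintype W₃] [Fintype Y] [Fintype Y₃]

/-- The channel as a function of the triple of its inputs. -/
def Model.channel (M : Model S₁ S₂ W W₃ X₁ X₂ X₃ Y Y₃) (a : X₁ × X₂ × X₃) : Y × Y₃ → ℝ :=
  M.chan a.1 a.2.1 a.2.2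

theorem Model.channel_mem (M : Model S₁ S₂ W W₃ X₁ X₂ X₃ Y Y₃) (a : X₁ × X₂ × X₃) :
    M.channel a ∈ stdSimplex ℝ (Y × Y₃) := M.chan_mem _ _ _

theorem sum_pi_prod {ι α β : Type*} [Fintype ι] [DecidableEq ι] [Fintype α] [Fintype β]
    (f : (ι → α) → (ι → β) → ℝ) :
    ∑ s : ι → α × β, f (fun i => (s i).1) (fun i => (s i).2) = ∑ a, ∑ b, f a b := by
  rw [← Fintype.sum_prod_type' (f := f)]
  exact Fintype.sum_equiv (Equiv.arrowProdEquivProdArrow ι (fun _ => α) (fun _ => β)) _ _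
    fun s => rfl

open Classical in
theorem errorProb_eq {m n : ℕ} (M : Model S₁ S₂ W W₃ X₁ X₂ X₃ Y Y₃)
    (c : Code S₁ S₂ W W₃ X₁ X₂ X₃ Y Y₃ m n) :
    errorProb M c = ∑ ω : (Fin m → S₁ × S₂ × W × W₃) × (Fin n → Y × Y₃),
      if c.g (fun k => (ω.2 k).1) (fun i => rvW (ω.1 i)) ≠
          (fun i => rvS₁ (ω.1 i), fun i => rvS₂ (ω.1 i)) ∨
        c.g₃ (fun k => (ω.2 k).2) (fun i => rvW₃ (ω.1 i)) ≠
          (fun i => rvS₁ (ω.1 i), fun i => rvS₂ (ω.1 i))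
      then processLaw M.src M.channel c.input ω else 0 := by
  unfold errorProb
  rw [Fintype.sum_prod_type]
  simp only [← sum_pi_prod (ι := Fin n), ← sum_pi_prod (ι := Fin m)]
  rfl

/-- A code of positive block length exists only for nonempty output alphabets. -/
theorem Code.nonempty_output {m n : ℕ} (M : Model S₁ S₂ W W₃ X₁ X₂ X₃ Y Y₃)
    (c : Code S₁ S₂ W W₃ X₁ X₂ X₃ Y Y₃ m n) (hn : 0 < n) : Nonempty (Y × Y₃) := by
  obtain ⟨s₀⟩ : Nonempty (S₁ × S₂ × W × W₃) := by
    by_contra h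
    rw [not_nonempty_iff] at h
    simpa using M.src_mem.2
  by_contra h
  have hF : IsEmpty (Y × Y₃) := not_nonempty_iff.1 h
  have hX : IsEmpty (X₁ × X₂ × X₃) := ⟨fun a => by simpa using (M.channel_mem a).2⟩
  have y₃ : Fin ((⟨0, hn⟩ : Fin n) : ℕ) → Y₃ := fun j => absurd j.isLt (Nat.not_lt_zero _)
  exact hX.elim (c.f₁ (fun _ => s₀.1) ⟨0, hn⟩, c.f₂ (fun _ => s₀.2.1) ⟨0, hn⟩,
    c.f₃ ⟨0, hn⟩ y₃ (fun _ => s₀.2.2.2))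

theorem Model.inOut_nonneg (M : Model S₁ S₂ W W₃ X₁ X₂ X₃ Y Y₃) {p : X₁ × X₂ × X₃ → ℝ}
    (hp : ∀ a, 0 ≤ p a) (ω : X₁ × X₂ × X₃ × Y × Y₃) : 0 ≤ M.inOut p ω :=
  mul_nonneg (hp _) ((M.chan_mem _ _ _).1 _)

variable [Fintype X₁] [Fintype X₂] [Fintype X₃]

theorem Model.inOut_eq_law (M : Model S₁ S₂ W W₃ X₁ X₂ X₃ Y Y₃) (p : X₁ × X₂ × X₃ → ℝ) :
    M.inOut p = law (pairLaw M.channel p)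
      (fun a => (a.1.1, a.1.2.1, a.1.2.2, a.2.1, a.2.2)) := by
  funext ω
  unfold law
  rw [Finset.sum_eq_single ((ω.1, ω.2.1, ω.2.2.1), ω.2.2.2)]
  · simp [Model.inOut, pairLaw, Model.channel]
  · rintro ⟨⟨a, b, c⟩, d, e⟩ _ h
    refine if_neg fun hcon => h ?_
    rw [← hcon]
  · simp

theorem sum_pairLaw {ξ ζ : Type*} [Fintype ξ] [Fintype ζ] {chan : ξ → ζ → ℝ}
    (hc : ∀ a, chan a ∈ stdSimplex ℝ ζ) (p : ξ → ℝ) : ∑ a, pairLaw chan p a = ∑ a, p a := by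
  rw [Fintype.sum_prod_type]
  simp [pairLaw, ← Finset.mul_sum, (hc _).2]

/-- `H(o(Z) | u(X)) - H(o(Z) | X)` is the mutual information of `o(Z)` and any `t(X)` that together
with `u(X)` determines `X`. -/
theorem Model.condMutualInfo_inOut (M : Model S₁ S₂ W W₃ X₁ X₂ X₃ Y Y₃)
    {p : X₁ × X₂ × X₃ → ℝ} (hp : ∀ a, 0 ≤ p a) {ν τ υ : Type*} [Fintype ν] [Fintype τ] [Fintype υ]
    (o : Y × Y₃ → ν) (t : X₁ × X₂ × X₃ → τ) (u : X₁ × X₂ × X₃ → υ)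
    (htu : ∀ a b, t a = t b → u a = u b → a = b) :
    condMutualInfo (M.inOut p) (fun ω => t (rvX₁ ω, rvX₂ ω, rvX₃ ω))
      (fun ω => o (rvY ω, rvY₃ ω)) (fun ω => u (rvX₁ ω, rvX₂ ω, rvX₃ ω)) =
      infoRate M.channel o u p := by
  have hq := pairLaw_nonneg M.channel_mem hp
  rw [condMutualInfo_eq (M.inOut_nonneg hp), infoRate, condEntropy_eq hq, condEntropy_eq hq,
    M.inOut_eq_law]
  simp only [entropy_law, rvX₁, rvX₂, rvX₃, rvY, rvY₃, Prod.mk.eta]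
  have h₁ : entropy (pairLaw M.channel p) (fun a => (t a.1, u a.1)) =
      entropy (pairLaw M.channel p) Prod.fst :=
    entropy_congr _ fun a b => by
      simp only [Prod.mk.injEq]
      exact ⟨fun h => htu _ _ h.1 h.2, fun h => by simp [h]⟩
  have h₂ : entropy (pairLaw M.channel p) (fun a => (t a.1, o a.2, u a.1)) =
      entropy (pairLaw M.channel p) (fun a => (o a.2, a.1)) :=
    entropy_congr _ fun a b => by
      simp only [Prod.mk.injEq]
      exact ⟨fun h => ⟨h.2.1, htu _ _ h.1 h.2.2⟩, fun h => by simp [h.1, h.2]⟩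
  rw [h₁, h₂]
  ring

/-- Conditioning on a constant is vacuous. Total mass one is needed for the constant to have entropy
zero. -/
theorem Model.mutualInfo_inOut (M : Model S₁ S₂ W W₃ X₁ X₂ X₃ Y Y₃)
    {p : X₁ × X₂ × X₃ → ℝ} (hp : p ∈ stdSimplex ℝ (X₁ × X₂ × X₃)) {ν : Type*} [Fintype ν]
    (o : Y × Y₃ → ν) :
    mutualInfo (M.inOut p) (fun ω => (rvX₁ ω, rvX₂ ω, rvX₃ ω)) (fun ω => o (rvY ω, rvY₃ ω)) =
      infoRate M.channel o (fun _ => ()) p := by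
  have hq := pairLaw_nonneg M.channel_mem hp.1
  rw [mutualInfo_eq (M.inOut_nonneg hp.1), infoRate, condEntropy_eq hq, condEntropy_eq hq,
    M.inOut_eq_law]
  simp only [entropy_law, rvX₁, rvX₂, rvX₃, rvY, rvY₃, Prod.mk.eta]
  rw [entropy_of_subsingleton (by rw [sum_pairLaw M.channel_mem, hp.2]) (fun _ => ()),
    entropy_congr _ (X := fun a : (X₁ × X₂ × X₃) × Y × Y₃ => (a.1, o a.2))
      (Y := fun a => (o a.2, a.1)) fun a b => by simp only [Prod.mk.injEq]; tauto,
    entropy_congr _ (X := fun a : (X₁ × X₂ × X₃) × Y × Y₃ => (o a.2, ()))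
      (Y := fun a => o a.2) fun a b => by simp]
  ring

/-- Entropy is continuous in the law even at vanishing masses. The restriction to the simplex
supplies the nonnegativity that reduces conditional entropies to entropies. -/
theorem continuousOn_infoRate {ξ ζ ν υ : Type*} [Fintype ξ] [Fintype ζ] [Fintype ν] [Fintype υ]
    {chan : ξ → ζ → ℝ} (hc : ∀ a, chan a ∈ stdSimplex ℝ ζ) (o : ζ → ν) (u : ξ → υ) :
    ContinuousOn (infoRate chan o u) (stdSimplex ℝ ξ) := by
  have hpair : Continuous (pairLaw chan) := by
    unfold pairLaw
    fun_prop
  refine ContinuousOn.congr (f := fun p =>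
    (entropy (pairLaw chan p) (fun a => (o a.2, u a.1)) -
      entropy (pairLaw chan p) (fun a => u a.1)) -
    (entropy (pairLaw chan p) (fun a => (o a.2, a.1)) - entropy (pairLaw chan p) Prod.fst)) ?_ ?_
  · exact ((((continuous_entropy _).comp hpair).sub ((continuous_entropy _).comp hpair)).sub
      (((continuous_entropy _).comp hpair).sub ((continuous_entropy _).comp hpair))).continuousOn
  · intro p hp
    have hq := pairLaw_nonneg hc hp.1
    simp only [infoRate, condEntropy_eq hq]

/-- Approximate solutions for `δ = 1/(N+1)` have a convergent subsequence; its limit satisfies all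
the inequalities simultaneously. -/
theorem exists_forall_le_of_approx {E ι : Type*} [TopologicalSpace E] [FirstCountableTopology E]
    {K : Set E} (hK : IsCompact K) {J : ι → E → ℝ} (hJ : ∀ i, ContinuousOn (J i) K) (h : ι → ℝ)
    (happrox : ∀ δ > 0, ∃ p ∈ K, ∀ i, h i ≤ J i p + δ) : ∃ p ∈ K, ∀ i, h i ≤ J i p := by
  have : Nonempty E := ⟨(happrox 1 one_pos).choose⟩
  choose! q hqK hq using happrox
  obtain ⟨p, hp, φ, hφ, hlim⟩ := hK.tendsto_subseq
    (x := fun N : ℕ => q (1 / ((N : ℝ) + 1))) fun N => hqK _ Nat.one_div_pos_of_nat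
  refine ⟨p, hp, fun i => ?_⟩
  have h₁ : Filter.Tendsto (fun N => J i (q (1 / ((φ N : ℕ) + 1 : ℝ)))) Filter.atTop
      (nhds (J i p)) :=
    (hJ i p hp).tendsto.comp (tendsto_nhdsWithin_iff.2
      ⟨hlim, Filter.Eventually.of_forall fun N => hqK _ Nat.one_div_pos_of_nat⟩)
  have h₂ : Filter.Tendsto (fun N => 1 / ((φ N : ℕ) + 1 : ℝ)) Filter.atTop (nhds 0) :=
    tendsto_one_div_add_atTop_nhds_zero_nat.comp hφ.tendsto_atTop
  have h₃ := h₁.add h₂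
  rw [add_zero] at h₃
  exact ge_of_tendsto h₃ (Filter.Eventually.of_forall fun N => hq _ Nat.one_div_pos_of_nat i)

open Classical in
/-- The converse for a code: a bound for one source component, when its decoding errors are
decoding errors of the code. -/
theorem Code.condEntropy_le {m n : ℕ} (M : Model S₁ S₂ W W₃ X₁ X₂ X₃ Y Y₃)
    (c : Code S₁ S₂ W W₃ X₁ X₂ X₃ Y Y₃ m n) {κ : ℝ} (hn : 0 < n) (hm : 0 < m)
    (hκ : (n : ℝ) ≤ κ * m) {α β ν υ : Type*} [Fintype α] [Fintype β] [Fintype ν] [Fintype υ]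
    (A : S₁ × S₂ × W × W₃ → α) (B : S₁ × S₂ × W × W₃ → β) (o : Y × Y₃ → ν)
    (u : X₁ × X₂ × X₃ → υ)
    (hu : ∀ k s s' z z', (∀ i, B (s i) = B (s' i)) → (∀ j < k, o (z j) = o (z' j)) →
      u (c.input k s z) = u (c.input k s' z'))
    (dec : (Fin m → β) → (Fin n → ν) → Fin m → α)
    (hdec : ∀ (s : Fin m → S₁ × S₂ × W × W₃) (z : Fin n → Y × Y₃),
      c.g (fun k => (z k).1) (fun i => rvW (s i)) = (fun i => rvS₁ (s i), fun i => rvS₂ (s i)) →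
      c.g₃ (fun k => (z k).2) (fun i => rvW₃ (s i)) = (fun i => rvS₁ (s i), fun i => rvS₂ (s i)) →
      dec (fun i => B (s i)) (fun k => o (z k)) = fun i => A (s i)) :
    condEntropy M.src A B ≤ κ * infoRate M.channel o u (avgInput M.src M.channel c.input) +
      (Real.log 2 / m + errorProb M c * Real.log (Fintype.card α)) := by
  have hζ := c.nonempty_output M hn
  have hP := processLaw_nonneg (x := c.input) M.src_mem M.channel_mem
  have hconv := converse M.src_mem M.channel_mem c.causalInput hn A B o u hu dec
    (ε := errorProb M c) (by
      rw [errorProb_eq]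
      refine Finset.sum_le_sum fun ω _ => ?_
      split_ifs with h₁ h₂ h₂
      · exact le_rfl
      · simp only [not_or, not_not] at h₂
        exact absurd (hdec _ _ h₂.1 h₂.2) h₁
      · exact hP ω
      · exact le_rfl)
  have hm' : (0 : ℝ) < m := by exact_mod_cast hm
  have hI := infoRate_nonneg M.channel_mem o u
    (avgInput_mem M.src_mem M.channel_mem c.causalInput hn).1
  -- Replacing `n` by `κ * m` is legitimate because the information rate is nonnegative; dividing by
  -- `m` then finishes.
  have h := hconv.trans (add_le_add_left (add_le_add_left (mul_le_mul_of_nonneg_right hκ hI) _) _)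
  refine le_of_mul_le_mul_left (h.trans (le_of_eq ?_)) hm'
  field_simp
  ring

end Setup

end MABRC

/-! ### The six bounds. -/

theorem theorem3
    {S₁ S₂ W W₃ X₁ X₂ X₃ Y Y₃ : Type*}
    [Fintype S₁] [Fintype S₂] [Fintype W] [Fintype W₃]
    [Fintype X₁] [Fintype X₂] [Fintype X₃] [Fintype Y] [Fintype Y₃]
    (M : MABRC.Model S₁ S₂ W W₃ X₁ X₂ X₃ Y Y₃) (κ : ℝ) (hκ : MABRC.Achievable M κ) :
    ∃ p ∈ stdSimplex ℝ (X₁ × X₂ × X₃),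
      (MABRC.condEntropy M.src MABRC.rvS₁ (fun ω => (MABRC.rvS₂ ω, MABRC.rvW ω)) ≤
        κ * MABRC.condMutualInfo (M.inOut p)
          (fun ω => (MABRC.rvX₁ ω, MABRC.rvX₃ ω)) MABRC.rvY MABRC.rvX₂) ∧
      (MABRC.condEntropy M.src MABRC.rvS₂ (fun ω => (MABRC.rvS₁ ω, MABRC.rvW ω)) ≤
        κ * MABRC.condMutualInfo (M.inOut p)
          (fun ω => (MABRC.rvX₂ ω, MABRC.rvX₃ ω)) MABRC.rvY MABRC.rvX₁) ∧
      (MABRC.condEntropy M.src (fun ω => (MABRC.rvS₁ ω, MABRC.rvS₂ ω)) MABRC.rvW ≤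
        κ * MABRC.mutualInfo (M.inOut p)
          (fun ω => (MABRC.rvX₁ ω, MABRC.rvX₂ ω, MABRC.rvX₃ ω)) MABRC.rvY) ∧
      (MABRC.condEntropy M.src MABRC.rvS₁ (fun ω => (MABRC.rvS₂ ω, MABRC.rvW₃ ω)) ≤
        κ * MABRC.condMutualInfo (M.inOut p)
          MABRC.rvX₁ MABRC.rvY₃ (fun ω => (MABRC.rvX₂ ω, MABRC.rvX₃ ω))) ∧
      (MABRC.condEntropy M.src MABRC.rvS₂ (fun ω => (MABRC.rvS₁ ω, MABRC.rvW₃ ω)) ≤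
        κ * MABRC.condMutualInfo (M.inOut p)
          MABRC.rvX₂ MABRC.rvY₃ (fun ω => (MABRC.rvX₁ ω, MABRC.rvX₃ ω))) ∧
      (MABRC.condEntropy M.src (fun ω => (MABRC.rvS₁ ω, MABRC.rvS₂ ω)) MABRC.rvW₃ ≤
        κ * MABRC.condMutualInfo (M.inOut p)
          (fun ω => (MABRC.rvX₁ ω, MABRC.rvX₂ ω)) MABRC.rvY₃ MABRC.rvX₃) := by
  open MABRC in
  let J : Fin 6 → (X₁ × X₂ × X₃ → ℝ) → ℝ :=
    ![infoRate M.channel Prod.fst (fun a => a.2.1),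
      infoRate M.channel Prod.fst (fun a => a.1),
      infoRate M.channel Prod.fst (fun _ => ()),
      infoRate M.channel Prod.snd (fun a => (a.2.1, a.2.2)),
      infoRate M.channel Prod.snd (fun a => (a.1, a.2.2)),
      infoRate M.channel Prod.snd (fun a => a.2.2)]
  let h : Fin 6 → ℝ :=
    ![condEntropy M.src rvS₁ (fun ω => (rvS₂ ω, rvW ω)),
      condEntropy M.src rvS₂ (fun ω => (rvS₁ ω, rvW ω)),
      condEntropy M.src (fun ω => (rvS₁ ω, rvS₂ ω)) rvW,
      condEntropy M.src rvS₁ (fun ω => (rvS₂ ω, rvW₃ ω)),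
      condEntropy M.src rvS₂ (fun ω => (rvS₁ ω, rvW₃ ω)),
      condEntropy M.src (fun ω => (rvS₁ ω, rvS₂ ω)) rvW₃]
  have hJ : ∀ i, ContinuousOn (J i) (stdSimplex ℝ (X₁ × X₂ × X₃)) := fun
    | 0 => continuousOn_infoRate M.channel_mem Prod.fst (fun a => a.2.1)
    | 1 => continuousOn_infoRate M.channel_mem Prod.fst (fun a => a.1)
    | 2 => continuousOn_infoRate M.channel_mem Prod.fst (fun _ => ())
    | 3 => continuousOn_infoRate M.channel_mem Prod.snd (fun a => (a.2.1, a.2.2))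
    | 4 => continuousOn_infoRate M.channel_mem Prod.snd (fun a => (a.1, a.2.2))
    | 5 => continuousOn_infoRate M.channel_mem Prod.snd (fun a => a.2.2)
  obtain ⟨p, hp, hle⟩ := exists_forall_le_of_approx (isCompact_stdSimplex (𝕜 := ℝ) (X₁ × X₂ × X₃))
    (J := fun i p => κ * J i p) (fun i => (hJ i).const_mul κ) h (by
    intro δ hδ
    set L := Real.log (Fintype.card S₁) + Real.log (Fintype.card S₂) +
      Real.log (Fintype.card (S₁ × S₂))
    have l₁ : 0 ≤ Real.log (Fintype.card S₁) := Real.log_natCast_nonneg _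
    have l₂ : 0 ≤ Real.log (Fintype.card S₂) := Real.log_natCast_nonneg _
    have l₃ : 0 ≤ Real.log (Fintype.card (S₁ × S₂)) := Real.log_natCast_nonneg _
    have hL : 0 ≤ L := by positivity
    obtain ⟨m₀, hm₀⟩ := exists_nat_gt (Real.log 2 / (δ / 2))
    -- Each Fano remainder is `log 2 / m` plus the error probability times a logarithm at most `L`;
    -- both are made at most `δ / 2`. The `+ 1` keeps the denominator positive when `L = 0`.
    obtain ⟨n, m, hn, hm, hnm, c, hc⟩ := hκ (δ / 2 / (L + 1)) (by positivity) 0 m₀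
    have hmpos : 0 < m := by omega
    have hm' : (0 : ℝ) < m := by exact_mod_cast hmpos
    have e₁ : Real.log 2 / m ≤ δ / 2 := by
      rw [div_lt_iff₀ (by positivity)] at hm₀
      rw [div_le_iff₀ hm']
      have : (m₀ : ℝ) < m := by exact_mod_cast hm
      nlinarith
    have e₂ : ∀ l, 0 ≤ l → l ≤ L → errorProb M c * l ≤ δ / 2 := by
      intro l h0 hl
      refine (mul_le_mul_of_nonneg_right hc.le h0).trans ?_
      rw [div_mul_eq_mul_div, div_le_iff₀ (by positivity)]
      nlinarith
    have hζ : Nonempty (Y × Y₃) := c.nonempty_output M hn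
    -- This input law depends on the code only, so it is common to the six bounds.
    refine ⟨_, avgInput_mem M.src_mem M.channel_mem c.causalInput hn, ?_⟩
    have bound {I l : ℝ} (h0 : 0 ≤ l) (hl : l ≤ L) :
        I + (Real.log 2 / m + errorProb M c * l) ≤ I + δ := by
      linarith [e₂ l h0 hl]
    have g₁ := (c.condEntropy_le M hn hmpos hnm rvS₁ (fun ω => (rvS₂ ω, rvW ω)) Prod.fst
      (fun a => a.2.1)
      (fun k s s' z z' hB _ => by
        simp only [Prod.mk.injEq] at hB
        simp only [Code.input, hB])
      (fun b v => (c.g v (fun i => (b i).2)).1)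
      (fun s z h₁ _ => by simp only [h₁])).trans (bound l₁ (by linarith))
    have g₂ := (c.condEntropy_le M hn hmpos hnm rvS₂ (fun ω => (rvS₁ ω, rvW ω)) Prod.fst
      (fun a => a.1)
      (fun k s s' z z' hB _ => by
        simp only [Prod.mk.injEq] at hB
        simp only [Code.input, hB])
      (fun b v => (c.g v (fun i => (b i).2)).2)
      (fun s z h₁ _ => by simp only [h₁])).trans (bound l₂ (by linarith))
    have g₃ := (c.condEntropy_le M hn hmpos hnm (fun ω => (rvS₁ ω, rvS₂ ω)) rvW Prod.fst
      (fun _ => ()) (fun k s s' z z' _ _ => rfl)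
      (fun b v i => ((c.g v b).1 i, (c.g v b).2 i))
      (fun s z h₁ _ => by simp only [h₁])).trans (bound l₃ (by linarith))
    -- At the relay, `x₃` may join the conditioning: `W₃` is part of `B` and the past of `Y₃` is the
    -- past of `o`.
    have g₄ := (c.condEntropy_le M hn hmpos hnm rvS₁ (fun ω => (rvS₂ ω, rvW₃ ω)) Prod.snd
      (fun a => (a.2.1, a.2.2))
      (fun k s s' z z' hB ho => by
        simp only [Prod.mk.injEq] at hB
        simp only [Code.input, hB, c.relayInput_congr k _ ho])
      (fun b v => (c.g₃ v (fun i => (b i).2)).1)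
      (fun s z _ h₃ => by simp only [h₃])).trans (bound l₁ (by linarith))
    have g₅ := (c.condEntropy_le M hn hmpos hnm rvS₂ (fun ω => (rvS₁ ω, rvW₃ ω)) Prod.snd
      (fun a => (a.1, a.2.2))
      (fun k s s' z z' hB ho => by
        simp only [Prod.mk.injEq] at hB
        simp only [Code.input, hB, c.relayInput_congr k _ ho])
      (fun b v => (c.g₃ v (fun i => (b i).2)).2)
      (fun s z _ h₃ => by simp only [h₃])).trans (bound l₂ (by linarith))
    have g₆ := (c.condEntropy_le M hn hmpos hnm (fun ω => (rvS₁ ω, rvS₂ ω)) rvW₃ Prod.snd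
      (fun a => a.2.2)
      (fun k s s' z z' hB ho => by
        simp only [Code.input, hB, c.relayInput_congr k _ ho])
      (fun b v i => ((c.g₃ v b).1 i, (c.g₃ v b).2 i))
      (fun s z _ h₃ => by simp only [h₃])).trans (bound l₃ (by linarith))
    exact fun
      | 0 => g₁
      | 1 => g₂
      | 2 => g₃
      | 3 => g₄
      | 4 => g₅
      | 5 => g₆)
  refine ⟨p, hp, ?_⟩
  have r₁ := M.condMutualInfo_inOut hp.1 Prod.fst (fun a => (a.1, a.2.2)) (fun a => a.2.1)
    (by simp +contextual [Prod.ext_iff])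
  have r₂ := M.condMutualInfo_inOut hp.1 Prod.fst (fun a => (a.2.1, a.2.2)) (fun a => a.1)
    (by simp +contextual [Prod.ext_iff])
  have r₃ := M.mutualInfo_inOut hp Prod.fst
  have r₄ := M.condMutualInfo_inOut hp.1 Prod.snd (fun a => a.1) (fun a => (a.2.1, a.2.2))
    (by simp +contextual [Prod.ext_iff])
  have r₅ := M.condMutualInfo_inOut hp.1 Prod.snd (fun a => a.2.1) (fun a => (a.1, a.2.2))
    (by simp +contextual [Prod.ext_iff])
  have r₆ := M.condMutualInfo_inOut hp.1 Prod.snd (fun a => (a.1, a.2.1)) (fun a => a.2.2)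
    (by simp +contextual [Prod.ext_iff])
  refine ⟨(hle 0).trans_eq (congrArg (κ * ·) r₁.symm), (hle 1).trans_eq (congrArg (κ * ·) r₂.symm),
    (hle 2).trans_eq (congrArg (κ * ·) r₃.symm), (hle 3).trans_eq (congrArg (κ * ·) r₄.symm),
    (hle 4).trans_eq (congrArg (κ * ·) r₅.symm), (hle 5).trans_eq (congrArg (κ * ·) r₆.symm)⟩
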